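/- Let $n$ players have non-empty closed convex action sets $S_i\subseteq\mathbb R^{k_i}$ and payoff functions $\pi_i$ on $S=S_1\times\dots\times S_n$. For $q\in S$ let $q_{-i}$ denote $q$ with its $i$-th component deleted. Let the best reply maps $f_i:\prod_{j\ne i}S_j\to S_i$ satisfy $\pi_i(q_i,q_{-i})<\pi_i(f_i(q_{-i}),q_{-i})$ for all $q\in S$ with $q_i\neq f_i(q_{-i})$, and let $q^*\in S$ be a Nash equilibrium, i.e. $q_i^*=f_i(q_{-i}^*)$ for all $i$. Call $\gamma:[0,\infty)\to[0,\infty)$ of class $\mathcal N$ if it is continuous, non-decreasing and $\gamma(0)=0$. Assume that there are $\tilde\gamma_{i,j}\in\mathcal N$ ($j\ne i$) with $$|f_i(q_{-i})-q_i^*|\le\max_{j\ne i}\tilde\gamma_{i,j}(|q_j-q_j^*|)\qquad\text{for all } q\in S,\ i=1,\dots,n$$ (a maximum over the empty set is $0$; $|\cdot|$ is the Euclidean norm). Let $0<r\le T$ and $0\le\Theta<1$ be constants, and consider the uncertain system, for $t>0$ and $i=1,\dots,n$, $$x_i(t)=\theta_i(t)\bigl(\mathrm{Pr}_{S_i}(x_i(t-\tau_i(t))+q_i^*)-q_i^*\bigr)+(1-\theta_i(t))\Bigl(f_i\bigl(\bigl(\mathrm{Pr}_{S_j}(q_j^*+d_{i,j}(t)\,\|x_j\|_{[t-T,t-r]})\bigr)_{j\ne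 i}\bigr)-q_i^*\Bigr),\qquad(3.7)$$ where $\mathrm{Pr}_U$ is the projection (nearest point map) on $U$, $\|y\|_{[a,b]}=\sup_{a\le s\le b}|y(s)|$, and the inputs are arbitrary functions $\theta_i:[0,\infty)\to[0,\Theta]$, $\tau_i:[0,\infty)\to[r,T]$ and $d_{i,j}:[0,\infty)\to\{d\in\mathbb R^{k_j}:|d|\le1\}$ ($j\ne i$). The $d_{i,j}$ encode arbitrary consistent backward-looking expectation rules, that is, expectations $q^{\exp}_{i,j}(t)=\mathrm{Pr}_{S_j}(q_j^*+d_{i,j}(t)\|x_j\|_{[t-T,t-r]})\in S_j$, which are exactly those with $|q^{\exp}_{i,j}(t)-q_j^*|\le\|x_j\|_{[t-T,t-r]}$. The state space $\mathcal X$ consists of the bounded functions $x_0:[-T,0]\to\mathbb R^{k_1+\dots+k_n}$ with the norm $\|x_0\|_{\mathcal X}=\sup_{[-T,0]}|x_0|$. A solution with initial condition $x_0\in\mathcal X$ is a function $x$ on $[-T,\infty)$ that equals $x_0$ on $[-T,0]$, satisfies (3.7) for all $t>0$ and has states $x_t=(x(t+s))_{s\in[-T,0]}\in\mathcal X$ for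 all $t\ge0$. Suppose that there is $\omega>1$ such that, with $\gamma_{i,j}(s)=\omega\tilde\gamma_{i,j}(\omega s)$, for each $p=2,\dots,n$ and all pairwise distinct $i_1,\dots,i_p\in\{1,\dots,n\}$, $$(\gamma_{i_1,i_2}\circ\gamma_{i_2,i_3}\circ\dots\circ\gamma_{i_p,i_1})(s)<s\qquad\text{for all } s>0 .$$ Then $0\in\mathcal X$ is robustly globally asymptotically stable for (3.7). That is: for every $x_0\in\mathcal X$ and all inputs there is exactly one solution; and, uniformly over all inputs, 1. for every $R\ge0$ there is $M$ such that $\|x_0\|_{\mathcal X}\le R$ implies $\|x_t\|_{\mathcal X}\le M$ for all $t\ge0$; 2. for every $\varepsilon>0$ there is $\delta>0$ such that $\|x_0\|_{\mathcal X}\le\delta$ implies $\|x_t\|_{\mathcal X}\le\varepsilon$ for all $t\ge0$; 3. for every $\varepsilon>0$ and $R\ge0$ there is $t_1\ge0$ such that $\|x_0\|_{\mathcal X}\le R$ implies $\|x_t\|_{\mathcal X}\le\varepsilon$ for all $t\ge t_1$. -/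

import Mathlib

open scoped NNReal

/-- `‖x‖_{[a,b]} = sup_{a ≤ s ≤ b} |x(s)|` (used only for `x` bounded on `[a,b]`, `a ≤ b`). -/
noncomputable def supNormOn {E : Type*} [Norm E] (x : ℝ → E) (a b : ℝ) : ℝ :=
  sSup ((fun s => ‖x s‖) '' Set.Icc a b)

/-- Class `𝒩`: non-decreasing continuous functions `ℝ⁺ → ℝ⁺` vanishing at `0`. -/
structure IsClassN (γ : ℝ≥0 → ℝ≥0) : Prop where
  monotone : Monotone γ
  continuous : Continuous γ
  map_zero : γ 0 = 0

/-- The composition `γ_{a,c₁} ∘ γ_{c₁,c₂} ∘ ⋯ ∘ γ_{c_m,b}` along `a, c₁, …, c_m, b`. -/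
def chainGain {ι : Type*} (γ : ι → ι → ℝ≥0 → ℝ≥0) : ι → List ι → ι → ℝ≥0 → ℝ≥0
  | a, [], b => γ a b
  | a, c :: l, b => γ a c ∘ chainGain γ c l b

/-- Cyclic small-gain conditions: for all pairwise distinct indices `i₁, …, i_p`, `p ≥ 2`
(here `i₁ = i` and `l = [i₂, …, i_p]`), `(γ_{i₁,i₂} ∘ ⋯ ∘ γ_{i_p,i₁})(s) < s` for all `s > 0`. -/
def CyclicSmallGain {ι : Type*} (γ : ι → ι → ℝ≥0 → ℝ≥0) : Prop :=
  ∀ (i : ι) (l : List ι), 2 ≤ (i :: l).length → (i :: l).Nodup →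
    ∀ s : ℝ≥0, 0 < s → chainGain γ i l i s < s

/-- Existence of a nearest point in a non-empty closed convex set. -/
theorem exists_nearest_point {m : ℕ} {U : Set (EuclideanSpace ℝ (Fin m))} (hne : U.Nonempty)
    (hcl : IsClosed U) (hcv : Convex ℝ U) (u : EuclideanSpace ℝ (Fin m)) :
    ∃ v : U, ∀ w : U, ‖u - v‖ ≤ ‖u - w‖ := by
  obtain ⟨v, hv, h⟩ := exists_norm_eq_iInf_of_complete_convex hne hcl.isComplete hcv u
  refine ⟨⟨v, hv⟩, fun w => ?_⟩
  rw [h]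
  exact ciInf_le ⟨0, by rintro _ ⟨z, rfl⟩; exact norm_nonneg _⟩ w

/-- The projection `Pr_U(u)`: the (unique) nearest point to `u` in the non-empty closed convex
set `U`. -/
noncomputable def convexProj {m : ℕ} {U : Set (EuclideanSpace ℝ (Fin m))} (hne : U.Nonempty)
    (hcl : IsClosed U) (hcv : Convex ℝ U) (u : EuclideanSpace ℝ (Fin m)) : U :=
  (exists_nearest_point hne hcl hcv u).choose

/-- An `n`-player game with closed convex action sets `S i ⊆ ℝ^{k i}` and payoff functions. -/
structure StrategicGame (n : ℕ) (k : Fin n → ℕ) where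
  S : ∀ i, Set (EuclideanSpace ℝ (Fin (k i)))
  nonempty : ∀ i, (S i).Nonempty
  isClosed : ∀ i, IsClosed (S i)
  convex : ∀ i, Convex ℝ (S i)
  payoff : Fin n → (∀ j, S j) → ℝ

namespace StrategicGame

variable {n : ℕ} {k : Fin n → ℕ} (G : StrategicGame n k)

/-- Outcomes `q = (q₁, …, q_n) ∈ S₁ × ⋯ × S_n`. -/
abbrev Outcome : Type := ∀ j, G.S j

/-- The type of families of maps `f_i : ∏_{j ≠ i} S_j → S_i`. -/
abbrev ReplyMap : Type := ∀ i, (∀ j : {j : Fin n // j ≠ i}, G.S j) → G.S i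

/-- The profile `q_{-i}` of the actions of the players other than `i`. -/
def others {G : StrategicGame n k} (q : G.Outcome) (i : Fin n) :
    ∀ j : {j : Fin n // j ≠ i}, G.S j := fun j => q j

/-- `f_i(q_{-i})` is the strict maximizer of `π_i(·, q_{-i})` on `S_i`. -/
def IsBestReply (f : G.ReplyMap) : Prop :=
  ∀ (i : Fin n) (q : G.Outcome) (y : G.S i), y ≠ f i (others q i) →
    G.payoff i (Function.update q i y) < G.payoff i (Function.update q i (f i (others q i)))

/-- `q` is a Nash equilibrium: `q_i = f_i(q_{-i})` for every player. -/
def IsNash (f : G.ReplyMap) (q : G.Outcome) : Prop :=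
  ∀ i, q i = f i (others q i)

/-- The projection on the action set of player `i`. -/
noncomputable def proj (i : Fin n) (u : EuclideanSpace ℝ (Fin (k i))) : G.S i :=
  convexProj (G.nonempty i) (G.isClosed i) (G.convex i) u

end StrategicGame

/-- The uncertain functions `θ_i : ℝ⁺ → [0,Θ]`, `τ_i : ℝ⁺ → [r,T]` and
`d_{i,j} : ℝ⁺ → {d ∈ ℝ^{k_j} : |d| ≤ 1}` (`j ≠ i`); values outside these ranges of the indices and
of time play no role. -/
structure UncertainInputs {n : ℕ} (k : Fin n → ℕ) (r T Θ : ℝ) where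
  θ : Fin n → ℝ → ℝ
  τ : Fin n → ℝ → ℝ
  d : ∀ _ j : Fin n, ℝ → EuclideanSpace ℝ (Fin (k j))
  θ_mem : ∀ i t, 0 ≤ t → θ i t ∈ Set.Icc 0 Θ
  τ_mem : ∀ i t, 0 ≤ t → τ i t ∈ Set.Icc r T
  d_le : ∀ i j t, j ≠ i → 0 ≤ t → ‖d i j t‖ ≤ 1

/-- Deviations live in `ℝ^{k₁ + ⋯ + k_n} = ℝ^{k₁} × ⋯ × ℝ^{k_n}` with its Euclidean norm. -/
abbrev Deviation {n : ℕ} (k : Fin n → ℕ) : Type :=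
  PiLp 2 fun i => EuclideanSpace ℝ (Fin (k i))

/-- The right-hand side of the `i`-th functional difference equation at time `t`. -/
noncomputable def fdeRhs {n : ℕ} {k : Fin n → ℕ} (G : StrategicGame n k) (f : G.ReplyMap)
    (qs : G.Outcome) {r T Θ : ℝ} (u : UncertainInputs k r T Θ) (x : ℝ → Deviation k)
    (t : ℝ) (i : Fin n) : EuclideanSpace ℝ (Fin (k i)) :=
  u.θ i t • ((G.proj i (x (t - u.τ i t) i + (qs i).1)).1 - (qs i).1)
    + (1 - u.θ i t) •
      ((f i fun j => G.proj j ((qs j).1 +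
          supNormOn (fun s => x s j) (t - T) (t - r) • u.d i j t)).1 - (qs i).1)

/-- `x`, of which only the restriction to `[-T, ∞)` matters, is the solution with initial
condition `x₀` (of which only the restriction to `[-T, 0]` matters): it agrees with `x₀` on
`[-T, 0]`, the states `x_t = x(t + ·)|_{[-T,0]}` are bounded functions for all `t ≥ 0`, and the
functional difference equations hold for all `t > 0`. -/
structure IsSolution {n : ℕ} {k : Fin n → ℕ} (G : StrategicGame n k) (f : G.ReplyMap)
    (qs : G.Outcome) {r T Θ : ℝ} (u : UncertainInputs k r T Θ) (x₀ x : ℝ → Deviation k) :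
    Prop where
  init : ∀ t ∈ Set.Icc (-T) 0, x t = x₀ t
  bounded : ∀ t, 0 ≤ t → BddAbove ((fun s => ‖x s‖) '' Set.Icc (t - T) t)
  eqn : ∀ t, 0 < t → ∀ i, x t i = fdeRhs G f qs u x t i

/-- `x₀` defines an element of the space `𝒳` of bounded functions on `[-T, 0]`, whose norm is
`supNormOn x₀ (-T) 0`. -/
def IsInitialState {n : ℕ} {k : Fin n → ℕ} (T : ℝ) (x₀ : ℝ → Deviation k) : Prop :=
  BddAbove ((fun s => ‖x₀ s‖) '' Set.Icc (-T) 0)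

/-- Robust global asymptotic stability of `0 ∈ 𝒳`, uniformly in the uncertain inputs: every
initial state and all inputs give exactly one solution on `[-T, ∞)`, and the solutions are
uniformly Lagrange stable, uniformly Lyapunov stable and uniformly attracted by `0`, where
`‖x_t‖_𝒳 = supNormOn x (t - T) t`. The system is autonomous, so the initial time is `0`. -/
structure IsRGAS {n : ℕ} {k : Fin n → ℕ} (G : StrategicGame n k) (f : G.ReplyMap)
    (qs : G.Outcome) (r T Θ : ℝ) : Prop where
  exists_solution : ∀ (u : UncertainInputs k r T Θ) (x₀ : ℝ → Deviation k),
    IsInitialState T x₀ → ∃ x, IsSolution G f qs u x₀ x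
  unique_solution : ∀ (u : UncertainInputs k r T Θ) (x₀ x y : ℝ → Deviation k),
    IsInitialState T x₀ → IsSolution G f qs u x₀ x → IsSolution G f qs u x₀ y →
      ∀ t, -T ≤ t → x t = y t
  lagrange : ∀ R : ℝ, 0 ≤ R → ∃ M : ℝ, ∀ (u : UncertainInputs k r T Θ) (x₀ x : ℝ → Deviation k),
    IsInitialState T x₀ → supNormOn x₀ (-T) 0 ≤ R → IsSolution G f qs u x₀ x →
      ∀ t, 0 ≤ t → supNormOn x (t - T) t ≤ M
  lyapunov : ∀ ε : ℝ, 0 < ε → ∃ δ : ℝ, 0 < δ ∧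
    ∀ (u : UncertainInputs k r T Θ) (x₀ x : ℝ → Deviation k),
      IsInitialState T x₀ → supNormOn x₀ (-T) 0 ≤ δ → IsSolution G f qs u x₀ x →
        ∀ t, 0 ≤ t → supNormOn x (t - T) t ≤ ε
  attractive : ∀ ε R : ℝ, 0 < ε → 0 ≤ R → ∃ t₁ : ℝ, 0 ≤ t₁ ∧
    ∀ (u : UncertainInputs k r T Θ) (x₀ x : ℝ → Deviation k),
      IsInitialState T x₀ → supNormOn x₀ (-T) 0 ≤ R → IsSolution G f qs u x₀ x →
        ∀ t, t₁ ≤ t → supNormOn x (t - T) t ≤ ε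

/-! The small-gain condition yields a continuous curve of vectors `σ(s) ≥ s` with `γ_{i,j}(σ_j(s)) ≤
σ_i(s)`, the maximum of the gains along simple paths (`exists_gain_path`). The margin `ω` turns this
into `γt_{i,j}(ω σ_j) ≤ ω⁻¹ σ_i`. While all deviations stay in the box `|x_j| ≤ ω σ_j(s)`, replies
thus land in the smaller box `ω⁻¹ σ(s)`. Each `x_i` is bounded by a convex combination of a reply
bound and its own past, so the box is invariant (`norm_apply_le_of_invariant`); this gives both
stability claims. For attraction, the excess over `ω⁻¹ σ_i(s)` decays like `Θ ^ m`
(`norm_apply_le_geometric`), so the box `σ(s)` is eventually reached. By continuity it lies in `ω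
σ(s')` for some `s' < s`. Hence the parameters of boxes reached in uniform time have infimum zero
(`mem_of_forall_mul_lt`). -/

/-- The composition `γ_{a,c₁} ∘ γ_{c₁,c₂} ∘ ⋯ ∘ γ_{c_{m-1},c_m}` along the path `a, c₁, …, c_m`. -/
def pathGain {ι : Type*} (γ : ι → ι → ℝ≥0 → ℝ≥0) : ι → List ι → ℝ≥0 → ℝ≥0
  | _, [] => id
  | a, c :: l => γ a c ∘ pathGain γ c l

/-! ### Path gains under cyclic small-gain conditions -/

section Gains

variable {ι : Type*} {γ : ι → ι → ℝ≥0 → ℝ≥0}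

theorem pathGain_append (a b : ι) (l₁ l₂ : List ι) (s : ℝ≥0) :
    pathGain γ a (l₁ ++ b :: l₂) s = chainGain γ a l₁ b (pathGain γ b l₂ s) := by
  induction l₁ generalizing a with
  | nil => rfl
  | cons c l ih => simp [pathGain, chainGain, ih]

theorem isClassN_pathGain_of_nodup (hγ : ∀ i j, j ≠ i → IsClassN (γ i j)) (a : ι) (l : List ι)
    (hl : (a :: l).Nodup) : IsClassN (pathGain γ a l) := by
  induction l generalizing a with
  | nil => exact ⟨monotone_id, continuous_id, rfl⟩
  | cons c l ih =>
    have hc := ih c hl.of_cons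
    have hac := hγ a c (by rintro rfl; simp at hl)
    exact ⟨hac.monotone.comp hc.monotone, hac.continuous.comp hc.continuous,
      by simp [pathGain, hc.map_zero, hac.map_zero]⟩

/-- The weak form of the small-gain condition, including `s = 0`: this allows a cycle to be cut out
of a path. -/
theorem chainGain_self_le (hγ : ∀ i j, j ≠ i → IsClassN (γ i j)) (hsg : CyclicSmallGain γ)
    (i c : ι) (l : List ι) (hl : (i :: c :: l).Nodup) (s : ℝ≥0) :
    chainGain γ i (c :: l) i s ≤ s := by
  rcases eq_or_ne s 0 with rfl | hs
  -- Only off-diagonal gains are known to vanish at `0`; the side conditions keep the last link from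
  -- being `γ i i`.
  · suffices h : ∀ (a : ι) (l : List ι), (a :: l).Nodup → i ∉ l → (l = [] → a ≠ i) →
        chainGain γ a l i 0 = 0 from
      (h i (c :: l) hl (List.nodup_cons.1 hl).1 (by simp)).le
    intro a l
    induction l generalizing a with
    | nil => exact fun _ _ ha => (hγ a i (ha rfl).symm).map_zero
    | cons b l ih =>
      intro hn hi _
      have hab := hγ a b (by rintro rfl; simp at hn)
      have hbi : b ≠ i := fun h => hi (by simp [h])
      simp [chainGain, ih b hn.of_cons (fun h => hi (by simp [h])) fun _ => hbi, hab.map_zero]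
  · exact (hsg i (c :: l) (by simp) hl s (pos_iff_ne_zero.2 hs)).le

/-- Under the cyclic small-gain conditions the pointwise maximum of the gains along simple paths
is a continuous curve of vectors which the gain operator does not increase. -/
theorem exists_gain_path [Fintype ι] (hγ : ∀ i j, j ≠ i → IsClassN (γ i j))
    (hsg : CyclicSmallGain γ) :
    ∃ σ : ι → ℝ≥0 → ℝ≥0, (∀ i, IsClassN (σ i)) ∧ (∀ i s, s ≤ σ i s) ∧
      ∀ i j s, j ≠ i → γ i j (σ j s) ≤ σ i s := by
  classical
  -- Duplicate-free lists over a finite type are finite in number, so the maximum over simple paths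
  -- is a finite one.
  let P : ι → Finset (List ι) := fun i =>
    (Finset.univ.image (Subtype.val : {l : List ι // l.Nodup} → List ι)).filter
      fun l => (i :: l).Nodup
  have hP : ∀ i l, l ∈ P i ↔ (i :: l).Nodup := fun i l => by
    simp only [P, Finset.mem_filter, Finset.mem_image, Finset.mem_univ, true_and, Subtype.exists,
      exists_prop, exists_eq_right, and_iff_right_iff_imp]
    exact fun h => h.of_cons
  have hN : ∀ i, ∀ l ∈ P i, IsClassN (pathGain γ i l) := fun i l hl =>
    isClassN_pathGain_of_nodup hγ i l ((hP i l).1 hl)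
  refine ⟨fun i s => (P i).sup fun l => pathGain γ i l s, fun i => ⟨fun s t hst => ?_, ?_, ?_⟩,
    fun i s => ?_, fun i j s hji => ?_⟩
  · exact Finset.sup_mono_fun fun l hl => (hN i l hl).monotone hst
  · exact Continuous.finset_sup_apply fun l hl => (hN i l hl).continuous
  · exact le_antisymm (Finset.sup_le fun l hl => (hN i l hl).map_zero.le) zero_le
  · exact Finset.le_sup (f := fun l => pathGain γ i l s) ((hP i []).2 (by simp))
  · have hne : (P j).Nonempty := ⟨[], (hP j []).2 (by simp)⟩
    obtain ⟨l, hl, hls⟩ := Finset.exists_mem_eq_sup (P j) hne fun l => pathGain γ j l s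
    simp only [hls]
    rw [hP] at hl
    -- Prepending `i` to a maximizing path gives a simple path, unless `i` already occurs; then the
    -- part up to that occurrence is a cycle, and dropping it does not lower the gain.
    by_cases hi : i ∈ j :: l
    · obtain ⟨l₁, l₂, h⟩ := List.append_of_mem hi
      cases l₁ with
      | nil => simp at h; exact absurd h.1 hji
      | cons c l₁ =>
        have hcat : γ i j (pathGain γ j l s) = pathGain γ i (j :: l) s := rfl
        rw [hcat, h, pathGain_append]
        rw [h] at hl
        obtain ⟨h₁, h₂, h₃⟩ := List.nodup_append.1 hl
        refine (chainGain_self_le hγ hsg i c l₁ (List.nodup_cons.2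
          ⟨fun hm => h₃ i hm i (by simp) rfl, h₁⟩) _).trans ?_
        exact Finset.le_sup (f := fun l => pathGain γ i l s) ((hP i l₂).2 h₂)
    · exact Finset.le_sup (f := fun l => pathGain γ i l s)
        ((hP i (j :: l)).2 (List.nodup_cons.2 ⟨hi, hl⟩))

end Gains

/-! ### Projections and norms -/

/-- By the variational inequality, the angle at the projection between `u` and `w` is not acute.
With `w = q*` it removes the projections from all estimates. -/
theorem norm_convexProj_sub_le {m : ℕ} {U : Set (EuclideanSpace ℝ (Fin m))} (hne : U.Nonempty)
    (hcl : IsClosed U) (hcv : Convex ℝ U) (u : EuclideanSpace ℝ (Fin m)) (w : U) :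
    ‖(convexProj hne hcl hcv u).1 - w.1‖ ≤ ‖u - w.1‖ := by
  have hspec : ∀ w : U, ‖u - convexProj hne hcl hcv u‖ ≤ ‖u - w‖ :=
    (exists_nearest_point hne hcl hcv u).choose_spec
  set v := convexProj hne hcl hcv u
  have : Nonempty U := ⟨v⟩
  have hinf : ‖u - v.1‖ = ⨅ w : U, ‖u - w‖ :=
    le_antisymm (le_ciInf hspec) (ciInf_le ⟨0, by rintro _ ⟨z, rfl⟩; exact norm_nonneg _⟩ v)
  have hin := (norm_eq_iInf_iff_real_inner_le_zero hcv v.2).1 hinf w.1 w.2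
  have h1 := norm_sub_sq_real (u - v.1) (w.1 - v.1)
  rw [sub_sub_sub_cancel_right] at h1
  rw [norm_sub_rev v.1 w.1]
  exact (sq_le_sq₀ (norm_nonneg _) (norm_nonneg _)).1 (by nlinarith [sq_nonneg ‖u - v.1‖])

theorem supNormOn_le {E : Type*} [Norm E] {x : ℝ → E} {a b C : ℝ} (hab : a ≤ b)
    (h : ∀ s ∈ Set.Icc a b, ‖x s‖ ≤ C) : supNormOn x a b ≤ C :=
  csSup_le ((Set.nonempty_Icc.2 hab).image _) (by rintro _ ⟨s, hs, rfl⟩; exact h s hs)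

theorem supNormOn_nonneg {E : Type*} [SeminormedAddGroup E] (x : ℝ → E) (a b : ℝ) :
    0 ≤ supNormOn x a b :=
  Real.sSup_nonneg (by rintro _ ⟨s, -, rfl⟩; exact norm_nonneg _)

theorem supNormOn_congr {E : Type*} [Norm E] {x y : ℝ → E} {a b : ℝ}
    (h : ∀ s ∈ Set.Icc a b, x s = y s) : supNormOn x a b = supNormOn y a b := by
  unfold supNormOn
  rw [Set.image_congr fun s hs => by rw [h s hs]]

theorem norm_le_sum_norm_apply {n : ℕ} {k : Fin n → ℕ} (v : Deviation k) :
    ‖v‖ ≤ ∑ i, ‖v i‖ := by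
  rw [PiLp.norm_eq_of_L2]
  exact Real.sqrt_le_iff.2 ⟨Finset.sum_nonneg fun i _ => norm_nonneg _,
    Finset.sum_sq_le_sq_sum_of_nonneg fun i _ => norm_nonneg _⟩

/-! ### Estimates, existence and uniqueness for the difference equations -/

section Dynamics

variable {n : ℕ} {k : Fin n → ℕ} {G : StrategicGame n k} {f : G.ReplyMap} {qs : G.Outcome}
  {γt : Fin n → Fin n → ℝ≥0 → ℝ≥0} {r T Θ : ℝ}

/-- The right-hand side at time `t` depends only on the values on `[t - T, t - r]`. -/
theorem fdeRhs_congr (u : UncertainInputs k r T Θ) {x y : ℝ → Deviation k} {t : ℝ} (ht : 0 ≤ t)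
    (h : ∀ s ∈ Set.Icc (t - T) (t - r), x s = y s) (i : Fin n) :
    fdeRhs G f qs u x t i = fdeRhs G f qs u y t i := by
  have hτ := u.τ_mem i t ht
  have h1 : x (t - u.τ i t) = y (t - u.τ i t) := h _ ⟨by linarith [hτ.2], by linarith [hτ.1]⟩
  have h2 : ∀ j, supNormOn (fun s => x s j) (t - T) (t - r) =
      supNormOn (fun s => y s j) (t - T) (t - r) := fun j =>
    supNormOn_congr fun s hs => by rw [h s hs]
  simp only [fdeRhs, h1, h2]

/-- The delayed own value is kept separate from the reply bound `a`, so that its weight `θ ≤ Θ` can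
later act as a contraction factor. -/
theorem norm_fdeRhs_le (hγt : ∀ i j, j ≠ i → Monotone (γt i j))
    (hbound : ∀ (q : G.Outcome) (i : Fin n),
      ‖(f i (StrategicGame.others q i)).1 - (qs i).1‖₊ ≤
        (Finset.univ.filter (fun j => j ≠ i)).sup fun j => γt i j ‖(q j).1 - (qs j).1‖₊)
    (hrT : r ≤ T) (hΘ1 : Θ < 1) (u : UncertainInputs k r T Θ) {x : ℝ → Deviation k} {t : ℝ}
    (ht : 0 ≤ t) {N : Fin n → ℝ≥0} {i : Fin n} {a : ℝ≥0}
    (hN : ∀ s ∈ Set.Icc (t - T) (t - r), ∀ j, ‖x s j‖ ≤ N j)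
    (ha : ∀ j, j ≠ i → γt i j (N j) ≤ a) :
    ‖fdeRhs G f qs u x t i‖ ≤ u.θ i t * ‖x (t - u.τ i t) i‖ + (1 - u.θ i t) * a := by
  obtain ⟨hθ0, hθ1⟩ := u.θ_mem i t ht
  have hproj : ∀ j (v : EuclideanSpace ℝ (Fin (k j))), ‖(G.proj j v).1 - (qs j).1‖ ≤
      ‖v - (qs j).1‖ := fun j v => norm_convexProj_sub_le _ _ _ v (qs j)
  refine (norm_add_le _ _).trans ?_
  rw [norm_smul, norm_smul, Real.norm_of_nonneg hθ0, Real.norm_of_nonneg (by linarith)]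
  refine add_le_add (mul_le_mul_of_nonneg_left ?_ hθ0)
    (mul_le_mul_of_nonneg_left ?_ (by linarith))
  · simpa using hproj i (x (t - u.τ i t) i + (qs i).1)
  · let q : G.Outcome := fun j => G.proj j ((qs j).1 +
      supNormOn (fun s => x s j) (t - T) (t - r) • u.d i j t)
    have hq : ‖(f i (StrategicGame.others q i)).1 - (qs i).1‖₊ ≤ a := by
      refine (hbound q i).trans (Finset.sup_le fun j hj => ?_)
      have hji : j ≠ i := (Finset.mem_filter.1 hj).2
      refine (hγt i j hji ?_).trans (ha j hji)
      rw [← NNReal.coe_le_coe, coe_nnnorm]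
      refine (hproj j _).trans ?_
      rw [add_sub_cancel_left, norm_smul, Real.norm_of_nonneg (supNormOn_nonneg _ _ _)]
      calc _ ≤ supNormOn (fun s => x s j) (t - T) (t - r) * 1 :=
            mul_le_mul_of_nonneg_left (u.d_le i j t hji ht) (supNormOn_nonneg _ _ _)
        _ ≤ N j := by
            rw [mul_one]
            exact supNormOn_le (by linarith) fun s hs => hN s hs j
    exact_mod_cast hq

/-- Induction in time steps of length `r`. -/
theorem forall_of_forall_le_sub {p : ℝ → Prop} (hr : 0 < r)
    (h : ∀ t, (∀ s, s ≤ t - r → p s) → p t) (h0 : ∀ t, t ≤ 0 → p t) (t : ℝ) : p t := by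
  have key : ∀ (m : ℕ) (t : ℝ), t ≤ m * r → p t := by
    intro m
    induction m with
    | zero => exact fun t ht => h0 t (by simpa using ht)
    | succ m ih => exact fun t ht => h t fun s hs => ih s (by push_cast at ht; linarith)
  obtain ⟨m, hm⟩ := exists_nat_ge (t / r)
  exact key m t ((div_le_iff₀ hr).1 hm)

/-- A convex combination of two numbers at most `N i` is at most `N i`. Boundedness of `x` is not
assumed, so existence of solutions can use this too. -/
theorem norm_apply_le_of_invariant (hγt : ∀ i j, j ≠ i → Monotone (γt i j))
    (hbound : ∀ (q : G.Outcome) (i : Fin n),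
      ‖(f i (StrategicGame.others q i)).1 - (qs i).1‖₊ ≤
        (Finset.univ.filter (fun j => j ≠ i)).sup fun j => γt i j ‖(q j).1 - (qs j).1‖₊)
    (hr : 0 < r) (hrT : r ≤ T) (hΘ1 : Θ < 1) (u : UncertainInputs k r T Θ)
    {x : ℝ → Deviation k} {N : Fin n → ℝ≥0} (hN : ∀ i j, j ≠ i → γt i j (N j) ≤ N i)
    (hinit : ∀ t ∈ Set.Icc (-T) 0, ∀ i, ‖x t i‖ ≤ N i)
    (heqn : ∀ t, 0 < t → ∀ i, x t i = fdeRhs G f qs u x t i) (t : ℝ) (ht : -T ≤ t) (i : Fin n) :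
    ‖x t i‖ ≤ N i := by
  refine forall_of_forall_le_sub (p := fun t => -T ≤ t → ∀ i, ‖x t i‖ ≤ N i) hr ?_
    (fun t h h' => hinit t ⟨h', h⟩) t ht i
  intro t ih htT i
  rcases le_or_gt t 0 with h | h
  · exact hinit t ⟨htT, h⟩ i
  rw [heqn t h i]
  have hτ := u.τ_mem i t h.le
  have hθ := u.θ_mem i t h.le
  have hstep := norm_fdeRhs_le hγt hbound hrT hΘ1 u h.le (i := i)
    (fun s hs => ih s hs.2 (by linarith [hs.1])) (hN i)
  have hx := ih (t - u.τ i t) (by linarith [hτ.1]) (by linarith [hτ.2]) i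
  nlinarith [mul_le_mul_of_nonneg_left hx hθ.1]

/-- Replies stay below `a` throughout, so each passage through the equation multiplies the bound on
the excess over `a` by at most `Θ`. The period `T + 1` covers the delay and ensures `t > 0` even
when `t₁ = -T`. -/
theorem norm_apply_le_geometric (hγt : ∀ i j, j ≠ i → Monotone (γt i j))
    (hbound : ∀ (q : G.Outcome) (i : Fin n),
      ‖(f i (StrategicGame.others q i)).1 - (qs i).1‖₊ ≤
        (Finset.univ.filter (fun j => j ≠ i)).sup fun j => γt i j ‖(q j).1 - (qs j).1‖₊)
    (hr : 0 < r) (hrT : r ≤ T) (hΘ0 : 0 ≤ Θ) (hΘ1 : Θ < 1) (u : UncertainInputs k r T Θ)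
    {x : ℝ → Deviation k} {N a : Fin n → ℝ≥0} (haN : ∀ i, a i ≤ N i)
    (ha : ∀ i j, j ≠ i → γt i j (N j) ≤ a i)
    (heqn : ∀ t, 0 < t → ∀ i, x t i = fdeRhs G f qs u x t i) {t₁ : ℝ} (ht₁ : -T ≤ t₁)
    (hN : ∀ t, t₁ ≤ t → ∀ i, ‖x t i‖ ≤ N i) (m : ℕ) :
    ∀ t, t₁ + m * (T + 1) ≤ t → ∀ i, ‖x t i‖ ≤ a i + Θ ^ m * (N i - a i) := by
  induction m with
  | zero => exact fun t ht i => by simpa using hN t (by simpa using ht) i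
  | succ m ih =>
    intro t ht i
    push_cast at ht
    have hm : 0 ≤ (m : ℝ) * (T + 1) := by have := hr.le.trans hrT; positivity
    have htp : 0 < t := by linarith
    rw [heqn t htp i]
    have hτ := u.τ_mem i t htp.le
    have hθ := u.θ_mem i t htp.le
    have hstep := norm_fdeRhs_le hγt hbound hrT hΘ1 u htp.le (i := i)
      (fun s hs => hN s (by linarith [hs.1])) (ha i)
    have hx := ih (t - u.τ i t) (by linarith [hτ.2]) i
    have hd : 0 ≤ Θ ^ m * ((N i : ℝ) - a i) :=
      mul_nonneg (pow_nonneg hΘ0 m) (sub_nonneg.2 (NNReal.coe_le_coe.2 (haN i)))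
    have h1 := mul_le_mul_of_nonneg_left hx hθ.1
    have h2 := mul_le_mul_of_nonneg_right hθ.2 hd
    calc _ ≤ _ := hstep
      _ ≤ a i + Θ * (Θ ^ m * (N i - a i)) := by linarith
      _ = _ := by ring

open Classical in
/-- The solution map of the functional difference equations with an initial condition `x₀`. -/
noncomputable def fdeStep (G : StrategicGame n k) (f : G.ReplyMap) (qs : G.Outcome)
    (u : UncertainInputs k r T Θ) (x₀ x : ℝ → Deviation k) (t : ℝ) : Deviation k :=
  if t ≤ 0 then x₀ t else WithLp.toLp 2 (fdeRhs G f qs u x t)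

/-- As delays are at least `r`, the iterates of the step map are constant on `(-∞, m * r]` from the
`m`-th on; the fixed point is pasted from them. -/
theorem exists_eq_fdeStep (hr : 0 < r) (u : UncertainInputs k r T Θ) (x₀ : ℝ → Deviation k) :
    ∃ x, x = fdeStep G f qs u x₀ x := by
  have hcongr : ∀ (x y : ℝ → Deviation k) (t : ℝ), (∀ s, s ≤ t - r → x s = y s) →
      fdeStep G f qs u x₀ x t = fdeStep G f qs u x₀ y t := by
    intro x y t h
    unfold fdeStep
    split_ifs with ht
    · rfl
    · congr 1
      funext i
      exact fdeRhs_congr u (not_le.1 ht).le (fun s hs => h s hs.2) i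
  let X : ℕ → ℝ → Deviation k := fun m => (fdeStep G f qs u x₀)^[m] x₀
  have hX : ∀ m, X (m + 1) = fdeStep G f qs u x₀ (X m) := fun m =>
    Function.iterate_succ_apply' _ _ _
  have hstab : ∀ (m : ℕ) (t : ℝ), t ≤ m * r → X (m + 1) t = X m t := by
    intro m
    induction m with
    | zero =>
      intro t ht
      rw [hX]
      simp [fdeStep, X, show t ≤ 0 by simpa using ht]
    | succ m ih =>
      intro t ht
      rw [hX (m + 1), hcongr _ _ t fun s hs => ih s (by push_cast at ht; linarith), ← hX m]
  have hstab' : ∀ (m l : ℕ) (t : ℝ), m ≤ l → t ≤ m * r → X l t = X m t := by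
    intro m l t hml ht
    induction l, hml using Nat.le_induction with
    | base => rfl
    | succ l hl ih =>
      rw [hstab l t (ht.trans (by gcongr)), ih]
  have hceil : ∀ t : ℝ, t ≤ ⌈t / r⌉₊ * r := fun t => (div_le_iff₀ hr).1 (Nat.le_ceil _)
  refine ⟨fun t => X ⌈t / r⌉₊ t, funext fun t => ?_⟩
  rw [← hstab _ t (hceil t), hX]
  refine hcongr _ _ t fun s hs => hstab' _ _ s (Nat.ceil_mono ?_) (hceil s)
  exact div_le_div_of_nonneg_right (by linarith) hr.le

theorem IsSolution.eq_of_isSolution (hr : 0 < r) {u : UncertainInputs k r T Θ}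
    {x₀ x y : ℝ → Deviation k} (hx : IsSolution G f qs u x₀ x) (hy : IsSolution G f qs u x₀ y)
    (t : ℝ) (ht : -T ≤ t) : x t = y t := by
  have h0 : ∀ t, t ≤ 0 → -T ≤ t → x t = y t := fun t h h' =>
    (hx.init t ⟨h', h⟩).trans (hy.init t ⟨h', h⟩).symm
  refine forall_of_forall_le_sub (p := fun t => -T ≤ t → x t = y t) hr (fun t ih htT => ?_) h0 t ht
  rcases le_or_gt t 0 with h | h
  · exact h0 t h htT
  ext1 i
  rw [hx.eqn t h i, hy.eqn t h i]
  exact fdeRhs_congr u h.le (fun s hs => ih s hs.2 (by linarith [hs.1])) i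

theorem norm_le_supNormOn_of_isInitialState {x₀ : ℝ → Deviation k} (h : IsInitialState T x₀)
    {t : ℝ} (ht : t ∈ Set.Icc (-T) 0) (i : Fin n) : ‖x₀ t i‖ ≤ supNormOn x₀ (-T) 0 :=
  (PiLp.norm_apply_le _ i).trans (le_csSup h ⟨t, ht, rfl⟩)

end Dynamics

/-! ### Descent along the gain curve -/

/-- A non-empty set of parameters of a curve of class `𝒩` functions contains every positive
parameter if each of its members may be replaced by any other at which the curve is smaller by at
most the factor `ω > 1`. -/
theorem mem_of_forall_mul_lt {ι : Type*} [Finite ι] {σ : ι → ℝ≥0 → ℝ≥0}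
    (hσ : ∀ i, IsClassN (σ i)) (hid : ∀ i s, s ≤ σ i s) {ω : ℝ≥0} (hω : 1 < ω) {A : Set ℝ≥0}
    (hne : A.Nonempty) (hstep : ∀ s ∈ A, ∀ s', (∀ i, σ i s ≤ ω * σ i s') → s' ∈ A) {ε : ℝ≥0}
    (hε : 0 < ε) : ε ∈ A := by
  have hup : ∀ s ∈ A, ∀ s', s ≤ s' → s' ∈ A := fun s hs s' h => hstep s hs s' fun i =>
    ((hσ i).monotone h).trans (le_mul_of_one_le_left zero_le hω.le)
  have hinf : sInf A = 0 := by
    by_contra h0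
    have hpos : 0 < sInf A := pos_iff_ne_zero.2 h0
    -- At a positive infimum each `σ i` is positive, so by continuity the factor `ω` absorbs a move
    -- from a member near the infimum to a point strictly below it.
    have hev : ∀ᶠ p : ℝ≥0 × ℝ≥0 in nhds (sInf A) ×ˢ nhds (sInf A),
        ∀ i, σ i p.1 < ω * σ i p.2 := by
      rw [← nhds_prod_eq, Filter.eventually_all]
      intro i
      refine (isOpen_lt ((hσ i).continuous.comp continuous_fst)
        (continuous_const.mul ((hσ i).continuous.comp continuous_snd))).mem_nhds ?_
      exact lt_mul_of_one_lt_left (hpos.trans_le (hid i _)) hω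
    obtain ⟨pa, hpa, pb, hpb, hp⟩ := Filter.eventually_prod_iff.1 hev
    obtain ⟨s, hsA, hs⟩ : ∃ s ∈ A, pa s := by
      obtain ⟨s, hs, hsA⟩ := (mem_closure_iff_nhds.1
        (csInf_mem_closure hne (OrderBot.bddBelow A))) _ hpa
      exact ⟨s, hsA, hs⟩
    have : (nhdsWithin (sInf A) (Set.Iio (sInf A))).NeBot := nhdsLT_neBot_of_exists_lt ⟨0, hpos⟩
    obtain ⟨s', hs', hlt⟩ := ((Filter.Eventually.filter_mono nhdsWithin_le_nhds hpb).and
      (self_mem_nhdsWithin (s := Set.Iio (sInf A)))).exists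
    exact (csInf_le (OrderBot.bddBelow A) (hstep s hsA s' fun i => (hp hs hs' i).le)).not_gt hlt
  obtain ⟨s, hs, hsε⟩ := exists_lt_of_csInf_lt hne (hinf.trans_lt hε)
  exact hup s hs ε hsε.le

theorem exists_pos_sum_le {ι : Type*} [Fintype ι] {σ : ι → ℝ≥0 → ℝ≥0}
    (hσ : ∀ i, IsClassN (σ i)) (ω : ℝ≥0) {ε : ℝ} (hε : 0 < ε) :
    ∃ ρ : ℝ≥0, 0 < ρ ∧ ∑ i, ((ω * σ i ρ : ℝ≥0) : ℝ) ≤ ε := by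
  have hc : Continuous fun ρ : ℝ≥0 => ∑ i, ((ω * σ i ρ : ℝ≥0) : ℝ) :=
    continuous_finsetSum _ fun i _ =>
      NNReal.continuous_coe.comp (continuous_const.mul (hσ i).continuous)
  have hev : ∀ᶠ ρ in nhds (0 : ℝ≥0), ∑ i, ((ω * σ i ρ : ℝ≥0) : ℝ) < ε :=
    hc.continuousAt.eventually_lt continuousAt_const (by simpa [(hσ _).map_zero] using hε)
  have : (nhdsWithin (0 : ℝ≥0) (Set.Ioi 0)).NeBot := nhdsGT_neBot_of_exists_gt ⟨1, one_pos⟩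
  obtain ⟨ρ, h, hρ⟩ := ((hev.filter_mono nhdsWithin_le_nhds).and
    (self_mem_nhdsWithin (s := Set.Ioi (0 : ℝ≥0)))).exists
  exact ⟨ρ, hρ, h.le⟩

/-! ### Robust global asymptotic stability -/

theorem theorem3p1 {n : ℕ} {k : Fin n → ℕ} (G : StrategicGame n k) (f : G.ReplyMap)
    (hf : G.IsBestReply f) (qs : G.Outcome) (hqs : G.IsNash f qs)
    (γt : Fin n → Fin n → ℝ≥0 → ℝ≥0) (hγt : ∀ i j, j ≠ i → IsClassN (γt i j))
    (hbound : ∀ (q : G.Outcome) (i : Fin n),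
      ‖(f i (StrategicGame.others q i)).1 - (qs i).1‖₊ ≤
        (Finset.univ.filter (fun j => j ≠ i)).sup fun j => γt i j ‖(q j).1 - (qs j).1‖₊)
    (ω : ℝ≥0) (hω : 1 < ω)
    (hsg : CyclicSmallGain fun i j s => ω * γt i j (ω * s))
    (r T Θ : ℝ) (hr : 0 < r) (hrT : r ≤ T) (hΘ0 : 0 ≤ Θ) (hΘ1 : Θ < 1) :
    IsRGAS G f qs r T Θ := by
  have hω0 : 0 < ω := one_pos.trans hω
  have hT : 0 < T := hr.trans_le hrT
  have hmono : ∀ i j, j ≠ i → Monotone (γt i j) := fun i j h => (hγt i j h).monotone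
  obtain ⟨σ, hσ, hid, hgain⟩ := exists_gain_path (fun i j hji => by
    have h := hγt i j hji
    have hl : Continuous fun s : ℝ≥0 => ω * s := continuous_const.mul continuous_id
    exact ⟨fun s t hst => mul_le_mul_right (h.monotone (mul_le_mul_right hst ω)) ω,
      continuous_const.mul (h.continuous.comp hl), by simp [h.map_zero]⟩) hsg
  -- The inner `ω` of the gain enlarges the box to `ω * σ`; the outer one shrinks its image to `ω⁻¹
  -- * σ`.
  have hdec : ∀ s i j, j ≠ i → γt i j (ω * σ j s) ≤ ω⁻¹ * σ i s := fun s i j hji => by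
    rw [le_inv_mul_iff₀ hω0]
    exact hgain i j s hji
  have hinvle : ∀ s i, ω⁻¹ * σ i s ≤ ω * σ i s := fun s i =>
    mul_le_mul_left ((inv_le_one_of_one_le₀ hω.le).trans hω.le) _
  have hself : ∀ s i, s ≤ ω * σ i s := fun s i =>
    (hid i s).trans (le_mul_of_one_le_left zero_le hω.le)
  have hinv : ∀ (ρ : ℝ≥0) (u : UncertainInputs k r T Θ) (x₀ x : ℝ → Deviation k),
      IsInitialState T x₀ → supNormOn x₀ (-T) 0 ≤ ρ → (∀ t ∈ Set.Icc (-T) 0, x t = x₀ t) →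
      (∀ t, 0 < t → ∀ i, x t i = fdeRhs G f qs u x t i) →
      ∀ t, -T ≤ t → ∀ i, ‖x t i‖ ≤ (ω * σ i ρ : ℝ≥0) := by
    intro ρ u x₀ x hx₀ hρ hx heqn
    refine norm_apply_le_of_invariant (N := fun i => ω * σ i ρ) hmono hbound hr hrT hΘ1 u
      (fun i j hji => (hdec ρ i j hji).trans (hinvle ρ i)) (fun t ht i => ?_) heqn
    rw [hx t ht]
    exact (norm_le_supNormOn_of_isInitialState hx₀ ht i).trans
      (hρ.trans (NNReal.coe_le_coe.2 (hself ρ i)))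
  have hsum : ∀ (ρ : ℝ≥0) (x : ℝ → Deviation k) (t : ℝ),
      (∀ s ∈ Set.Icc (t - T) t, ∀ i, ‖x s i‖ ≤ (ω * σ i ρ : ℝ≥0)) →
      supNormOn x (t - T) t ≤ ∑ i, ((ω * σ i ρ : ℝ≥0) : ℝ) := fun ρ x t h =>
    supNormOn_le (by linarith) fun s hs =>
      (norm_le_sum_norm_apply _).trans (Finset.sum_le_sum fun i _ => h s hs i)
  refine ⟨fun u x₀ hx₀ => ?_, fun u x₀ x y _ hx hy => hx.eq_of_isSolution hr hy,
    fun R hR => ?_, fun ε hε => ?_, fun ε R hε hR => ?_⟩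
  · obtain ⟨x, hx⟩ := exists_eq_fdeStep (G := G) (f := f) (qs := qs) hr u x₀
    have hinit : ∀ t ∈ Set.Icc (-T) 0, x t = x₀ t := fun t ht => by
      rw [hx]; exact if_pos ht.2
    have heqn : ∀ t, 0 < t → ∀ i, x t i = fdeRhs G f qs u x t i := fun t ht i => by
      conv_lhs => rw [hx]
      simp [fdeStep, not_le.2 ht]
    let ρ : ℝ≥0 := ⟨supNormOn x₀ (-T) 0, supNormOn_nonneg _ _ _⟩
    refine ⟨x, hinit, fun t ht => ⟨∑ i, ((ω * σ i ρ : ℝ≥0) : ℝ), ?_⟩, heqn⟩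
    rintro _ ⟨s, hs, rfl⟩
    exact (norm_le_sum_norm_apply _).trans (Finset.sum_le_sum fun i _ =>
      hinv ρ u x₀ x hx₀ le_rfl hinit heqn s (by linarith [hs.1]) i)
  · lift R to ℝ≥0 using hR
    exact ⟨_, fun u x₀ x hx₀ hR hx t ht => hsum R x t fun s hs =>
      hinv R u x₀ x hx₀ hR hx.init hx.eqn s (by linarith [hs.1])⟩
  · obtain ⟨ρ, hρ, hle⟩ := exists_pos_sum_le hσ ω hε
    exact ⟨ρ, hρ, fun u x₀ x hx₀ hR hx t ht => (hsum ρ x t fun s hs =>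
      hinv ρ u x₀ x hx₀ hR hx.init hx.eqn s (by linarith [hs.1])).trans hle⟩
  · lift R to ℝ≥0 using hR
    obtain ⟨ρ, hρ, hle⟩ := exists_pos_sum_le hσ ω hε
    -- The time `t₁` precedes the quantifiers over inputs and initial states, so membership already
    -- contains the required uniformity.
    let A : Set ℝ≥0 := {ρ | ∃ t₁ : ℝ, 0 ≤ t₁ ∧ ∀ (u : UncertainInputs k r T Θ)
      (x₀ x : ℝ → Deviation k), IsInitialState T x₀ → supNormOn x₀ (-T) 0 ≤ R →
        IsSolution G f qs u x₀ x → ∀ t, t₁ ≤ t → ∀ i, ‖x t i‖ ≤ (ω * σ i ρ : ℝ≥0)}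
    have hRA : R ∈ A := ⟨0, le_rfl, fun u x₀ x hx₀ hR hx t ht =>
      hinv R u x₀ x hx₀ hR hx.init hx.eqn t (by linarith)⟩
    have hω1 : (1 : ℝ) < ω := hω
    -- Chosen so that `ω⁻¹ + Θ ^ m * (ω - ω⁻¹) ≤ 1`, which brings the bound from `ω * σ i s` down to
    -- `σ i s`.
    obtain ⟨m, hm⟩ := exists_pow_lt_of_lt_one
      (show (0 : ℝ) < (1 - (ω : ℝ)⁻¹) / ω from
        div_pos (sub_pos.2 (inv_lt_one_of_one_lt₀ hω1)) (by linarith)) hΘ1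
    obtain ⟨t₁, ht₁, h⟩ : ρ ∈ A := by
      refine mem_of_forall_mul_lt hσ hid hω ⟨R, hRA⟩ ?_ hρ
      rintro s ⟨t₁, ht₁, h⟩ s' hs'
      refine ⟨t₁ + m * (T + 1), by positivity, fun u x₀ x hx₀ hR hx t ht i => ?_⟩
      refine (norm_apply_le_geometric (N := fun i => ω * σ i s) (a := fun i => ω⁻¹ * σ i s)
        hmono hbound hr hrT hΘ0 hΘ1 u (hinvle s) (hdec s) hx.eqn (by linarith)
        (h u x₀ x hx₀ hR hx) m t ht i).trans
        (le_trans ?_ (NNReal.coe_le_coe.2 (hs' i)))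
      push_cast
      have hσ0 : 0 ≤ (σ i s : ℝ) := NNReal.coe_nonneg _
      have hωi : 0 < (ω : ℝ)⁻¹ := inv_pos.2 (by linarith)
      have h1 : Θ ^ m * ω ≤ 1 - (ω : ℝ)⁻¹ := ((lt_div_iff₀ (by linarith)).1 hm).le
      have h2 : 0 ≤ Θ ^ m * (ω : ℝ)⁻¹ := mul_nonneg (pow_nonneg hΘ0 m) hωi.le
      nlinarith [mul_le_mul_of_nonneg_right h1 hσ0, mul_nonneg h2 hσ0]
    exact ⟨t₁ + T, by linarith, fun u x₀ x hx₀ hR hx t ht => (hsum ρ x t fun s hs =>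
      h u x₀ x hx₀ hR hx s (by linarith [hs.1])).trans hle⟩
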